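/- Let $R$ be an associative ring with unit, not necessarily commutative. An $\mathcal R$-module is an additive covariant functor from left $R$-modules to abelian groups; images of morphisms (natural transformations) of $\mathcal R$-modules are computed pointwise. For a right $R$-module $M$ let $\mathcal M$ be the $\mathcal R$-module $\mathcal M(S)=M\otimes_R S$; in particular $\mathcal R(S)=R\otimes_R S\cong S$. An $\mathcal R$-module is an FP module if it preserves direct limits (colimits over upward directed sets) and direct products of arbitrary families. A right $R$-module $M$ is Mittag-Leffler if for every morphism $f\colon P\to M$ of right $R$-modules with $P$ finitely presented there is a morphism $g\colon P\to Q$ with $Q$ finitely presented such that $\operatorname{Ker}(f\otimes_R N)=\operatorname{Ker}(g\otimes_R N)$ for every left $R$-module $N$. Theorem. Let $M$ be a right $R$-module. The following are equivalent: 1. $M$ is a Mittag-Leffler module. 2. For every $n\in\mathbb N$, the image of every morphism of $\mathcal R$-modules $\mathcal R^n\to\mathcal M$ is an FP module. 3. The image of every morphism of $\mathcal R$-modules $\prod_{\mathbb N}\mathcal R\to\mathcal M$ is an FP module. 4. The image of every morphism of $\mathcal R$-modules $\prod_{\mathbb N}\mathcal R\to\mathcal M$ preserves direct products. -/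

import Mathlib

open CategoryTheory CategoryTheory.Limits
open scoped TensorProduct MulOpposite

universe u

noncomputable section

/-- The subgroup of `M ⊗[ℤ] S` generated by the elements `m r ⊗ s - m ⊗ r s`. -/
def balancedRelations (R M S : Type u) [Ring R] [AddCommGroup M] [Module Rᵐᵒᵖ M]
    [AddCommGroup S] [Module R S] : AddSubgroup (M ⊗[ℤ] S) :=
  AddSubgroup.closure
    {x | ∃ (m : M) (r : R) (s : S), x = (MulOpposite.op r • m) ⊗ₜ[ℤ] s - m ⊗ₜ[ℤ] (r • s)}

/-- The tensor product `M ⊗_R S` of a right module `M` and a left module `S` over a not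
necessarily commutative ring `R`, an abelian group. Right `R`-modules are modules over `Rᵐᵒᵖ`. -/
abbrev TensorOver (R M S : Type u) [Ring R] [AddCommGroup M] [Module Rᵐᵒᵖ M]
    [AddCommGroup S] [Module R S] : Type u :=
  (M ⊗[ℤ] S) ⧸ balancedRelations R M S

/-- The map `f ⊗ g : M ⊗_R S → N ⊗_R T` induced by a morphism `f : M → N` of right modules and a
morphism `g : S → T` of left modules. -/
def TensorOver.map {R M N S T : Type u} [Ring R] [AddCommGroup M] [Module Rᵐᵒᵖ M]
    [AddCommGroup N] [Module Rᵐᵒᵖ N] [AddCommGroup S] [Module R S] [AddCommGroup T] [Module R T]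
    (f : M →ₗ[Rᵐᵒᵖ] N) (g : S →ₗ[R] T) : TensorOver R M S →+ TensorOver R N T :=
  QuotientAddGroup.map (balancedRelations R M S) (balancedRelations R N T)
    (TensorProduct.map f.toAddMonoidHom.toIntLinearMap
      g.toAddMonoidHom.toIntLinearMap).toAddMonoidHom
    (by
      rw [balancedRelations, AddSubgroup.closure_le]
      rintro _ ⟨m, r, s, rfl⟩
      refine AddSubgroup.subset_closure ⟨f m, r, g s, ?_⟩
      simp)

/-- The quasi-coherent functor `S ↦ M ⊗_R S` associated with a right `R`-module `M`. -/
def quasiCoherent (R M : Type u) [Ring R] [AddCommGroup M] [Module Rᵐᵒᵖ M] :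
    ModuleCat.{u} R ⥤ AddCommGrpCat.{u} where
  obj S := AddCommGrpCat.of (TensorOver R M S)
  map g := AddCommGrpCat.ofHom (TensorOver.map LinearMap.id g.hom)
  map_id S := by
    ext x
    induction x using TensorProduct.induction_on with
    | zero => exact map_zero _
    | tmul m s => rfl
    | add x y hx hy => exact (map_add _ _ _).trans (congrArg₂ (· + ·) hx hy)
  map_comp g h := by
    ext x
    induction x using TensorProduct.induction_on with
    | zero => exact (map_zero _).trans (map_zero _).symm
    | tmul m s => rfl
    | add x y hx hy =>
      exact ((map_add _ _ _).trans (congrArg₂ (· + ·) hx hy)).trans (map_add _ _ _).symm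

/-- `F` preserves direct limits, that is, colimits of direct systems indexed by (nonempty)
upward directed sets. -/
def PreservesDirectLimits {R : Type u} [Ring R] (F : ModuleCat.{u} R ⥤ AddCommGrpCat.{u}) :
    Prop :=
  ∀ (I : Type u) [Preorder I] [IsDirectedOrder I] [Nonempty I], PreservesColimitsOfShape I F

/-- `F` preserves direct products of arbitrary families. -/
def PreservesDirectProducts {R : Type u} [Ring R] (F : ModuleCat.{u} R ⥤ AddCommGrpCat.{u}) :
    Prop :=
  ∀ I : Type u, PreservesLimitsOfShape (Discrete I) F

/-- An FP module: an additive functor from left `R`-modules to abelian groups that preserves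
direct limits and direct products. -/
structure IsFPModule {R : Type u} [Ring R] (F : ModuleCat.{u} R ⥤ AddCommGrpCat.{u}) :
    Prop where
  additive : F.Additive
  directLimits : PreservesDirectLimits F
  directProducts : PreservesDirectProducts F

/-- A right `R`-module `M` is Mittag-Leffler if for every morphism `f : P → M` with `P` finitely
presented there are a finitely presented `Q` and a morphism `g : P → Q` such that `f` and `g`
dominate each other: `ker (f ⊗ N) = ker (g ⊗ N)` for every left `R`-module `N`. -/
def IsMittagLeffler (R M : Type u) [Ring R] [AddCommGroup M] [Module Rᵐᵒᵖ M] : Prop :=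
  ∀ (P : Type u) [AddCommGroup P] [Module Rᵐᵒᵖ P] [Module.FinitePresentation Rᵐᵒᵖ P]
    (f : P →ₗ[Rᵐᵒᵖ] M),
    ∃ (Q : Type u) (_ : AddCommGroup Q) (_ : Module Rᵐᵒᵖ Q)
      (_ : Module.FinitePresentation Rᵐᵒᵖ Q) (g : P →ₗ[Rᵐᵒᵖ] Q),
      ∀ (N : Type u) [AddCommGroup N] [Module R N],
        (TensorOver.map f (LinearMap.id : N →ₗ[R] N)).ker =
          (TensorOver.map g (LinearMap.id : N →ₗ[R] N)).ker

/-- The direct product `∏_I 𝓡` in the category of functors, where `𝓡` is the quasi-coherent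
functor associated with the right `R`-module `R`. -/
abbrev ringFunctorPower (R : Type u) [Ring R] (I : Type) [Countable I] :
    ModuleCat.{u} R ⥤ AddCommGrpCat.{u} :=
  ∏ᶜ fun _ : I => quasiCoherent R R

end

/-! The pivot is `InjectiveOnProducts`: M is Mittag-Leffler iff the canonical maps M ⊗ ∏ S_j → ∏ (M
⊗ S_j) are injective. Finitely presented modules have this property, and a Mittag-Leffler module
inherits it because its kernels are those of maps into finitely presented modules. Conversely, all
relations of a finite tuple of M with coefficients in finitely generated left modules can be packed
into one tensor over a product. Injectivity makes that tensor vanish, and a vanishing tensor already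
vanishes over some finitely presented Q → M; this Q dominates the tuple.

On the functor side, ∏_I 𝓡 is S ↦ S^I, corepresented by R^(I), so by Yoneda its morphisms to 𝓜 are
the finite sums s ↦ ∑ m_i ⊗ s_i (`exists_eq_powerFunctorHom`). An image F is thus a quotient of S^I
and a subfunctor of M ⊗ S. Surjectivity of F(∏ S_j) → ∏ F(S_j) comes from S^I, injectivity from M.
Direct limits are preserved for every M, since the sums are finite and tensor products commute with
direct limits. Conversely, every tensor in M ⊗ ∏ S_j is a value of such a morphism, so if the images
preserve products, it vanishes as soon as its components do. -/

noncomputable section Algebra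

/-! ### Tensor products over a noncommutative ring: right exactness and vanishing of tensors -/

namespace TensorOver

variable {R M N S T : Type u} [Ring R] [AddCommGroup M] [Module Rᵐᵒᵖ M]
    [AddCommGroup N] [Module Rᵐᵒᵖ N] [AddCommGroup S] [Module R S] [AddCommGroup T] [Module R T]

variable (R) in
/-- The universal balanced biadditive map `M × S → M ⊗_R S`. -/
def tmul : M →+ S →+ TensorOver R M S :=
  AddMonoidHom.mk' (fun m => AddMonoidHom.mk' (fun s => QuotientAddGroup.mk (m ⊗ₜ[ℤ] s))
      (fun s t => by rw [TensorProduct.tmul_add]; rfl))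
    (fun m n => by
      ext s
      change QuotientAddGroup.mk _ = _
      rw [TensorProduct.add_tmul]; rfl)

theorem smul_tmul (r : R) (m : M) (s : S) :
    tmul R (MulOpposite.op r • m) s = tmul R m (r • s) := by
  rw [← sub_eq_zero]
  exact (QuotientAddGroup.eq_zero_iff _).2 (AddSubgroup.subset_closure ⟨m, r, s, rfl⟩)

theorem op_smul_tmul (r : Rᵐᵒᵖ) (m : M) (s : S) :
    tmul R (r • m) s = tmul R m (r.unop • s) :=
  smul_tmul r.unop m s

@[simp]
theorem map_tmul (f : M →ₗ[Rᵐᵒᵖ] N) (g : S →ₗ[R] T) (m : M) (s : S) :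
    map f g (tmul R m s) = tmul R (f m) (g s) := rfl

/-- The homomorphism out of `M ⊗_R S` induced by a balanced biadditive map. -/
def lift {A : Type*} [AddCommGroup A] (φ : M →+ S →+ A)
    (h : ∀ (r : R) m s, φ (MulOpposite.op r • m) s = φ m (r • s)) : TensorOver R M S →+ A :=
  QuotientAddGroup.lift _
    (TensorProduct.liftAddHom φ fun (r : ℤ) m s => by simp)
    (by
      rw [balancedRelations, AddSubgroup.closure_le]
      rintro _ ⟨m, r, s, rfl⟩
      change _ = _
      simp [h])

theorem induction_on {p : TensorOver R M S → Prop} (x : TensorOver R M S)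
    (h0 : p 0) (ht : ∀ m s, p (tmul R m s)) (ha : ∀ x y, p x → p y → p (x + y)) : p x := by
  induction x using QuotientAddGroup.induction_on with
  | H x =>
    induction x using TensorProduct.induction_on with
    | zero => exact h0
    | tmul m s => exact ht m s
    | add x y hx hy => exact ha _ _ hx hy

theorem hom_ext {A : Type*} [AddCommGroup A] {φ ψ : TensorOver R M S →+ A}
    (h : ∀ m s, φ (tmul R m s) = ψ (tmul R m s)) : φ = ψ := by
  refine DFunLike.ext _ _ fun x => ?_
  induction x using induction_on with
  | h0 => simp
  | ht m s => exact h m s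
  | ha x y hx hy => rw [map_add, map_add, hx, hy]

theorem map_map {M' S' : Type u} [AddCommGroup M'] [Module Rᵐᵒᵖ M'] [AddCommGroup S']
    [Module R S'] (f : M →ₗ[Rᵐᵒᵖ] N) (g : S →ₗ[R] T) (f' : N →ₗ[Rᵐᵒᵖ] M') (g' : T →ₗ[R] S')
    (x : TensorOver R M S) : map f' g' (map f g x) = map (f' ∘ₗ f) (g' ∘ₗ g) x := by
  have : (map f' g').comp (map f g) = map (f' ∘ₗ f) (g' ∘ₗ g) := hom_ext fun _ _ => rfl
  exact DFunLike.congr_fun this x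

theorem map_surjective {f : M →ₗ[Rᵐᵒᵖ] N} (hf : Function.Surjective f) :
    Function.Surjective (map f (LinearMap.id : S →ₗ[R] S)) := by
  intro y
  induction y using induction_on with
  | h0 => exact ⟨0, map_zero _⟩
  | ht m s =>
    obtain ⟨m, rfl⟩ := hf m
    exact ⟨tmul R m s, rfl⟩
  | ha x y hx hy =>
    obtain ⟨x, rfl⟩ := hx
    obtain ⟨y, rfl⟩ := hy
    exact ⟨x + y, map_add _ _ _⟩

/-- Right exactness of the tensor product. -/
theorem mem_closure_of_map_eq_zero {f : M →ₗ[Rᵐᵒᵖ] N} (hf : Function.Surjective f)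
    {x : TensorOver R M S} (hx : map f (LinearMap.id : S →ₗ[R] S) x = 0) :
    x ∈ AddSubgroup.closure {y | ∃ k s, f k = 0 ∧ y = tmul R k s} := by
  set A := AddSubgroup.closure {y | ∃ (k : M) (s : S), f k = 0 ∧ y = tmul R k s} with hA
  have key : ∀ (k l : M) (s : S), f k = f l →
      (tmul R k s : TensorOver R M S ⧸ A) = tmul R l s := by
    intro k l s h
    rw [← sub_eq_zero, ← QuotientAddGroup.mk_sub, QuotientAddGroup.eq_zero_iff]
    refine AddSubgroup.subset_closure ⟨k - l, s, by simp [h], by simp⟩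
  -- The section σ is only set-theoretic; modulo A the choice of preimage is immaterial by `key`, so
  -- it induces an additive balanced inverse.
  have hσ := Function.surjInv_eq hf
  let σ := Function.surjInv hf
  let φ : N →+ S →+ TensorOver R M S ⧸ A :=
    AddMonoidHom.mk' (fun n => (QuotientAddGroup.mk' A).comp (tmul R (σ n))) (fun m n => by
      ext s
      refine (key _ (σ m + σ n) s (by simp [σ, hσ])).trans ?_
      simp)
  let ψ : TensorOver R N S →+ TensorOver R M S ⧸ A := lift φ (fun r m s => by
    refine (key _ (MulOpposite.op r • σ m) s (by simp [σ, hσ])).trans ?_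
    rw [smul_tmul]
    rfl)
  have h : ψ.comp (map f LinearMap.id) = QuotientAddGroup.mk' A :=
    hom_ext fun m s => key _ _ _ (hσ _)
  rw [← QuotientAddGroup.eq_zero_iff]
  have := DFunLike.congr_fun h x
  simp only [AddMonoidHom.comp_apply, hx, map_zero] at this
  exact this.symm

/-- The isomorphism `M ⊗_R R → M`, as a homomorphism. -/
def toModule : TensorOver R M R →+ M :=
  lift (AddMonoidHom.mk' (fun m => AddMonoidHom.mk' (fun r => MulOpposite.op r • m)
    (fun r s => by simp [add_smul])) (fun m n => by ext; simp))
    (fun r m s => by simp [mul_smul])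

/-- The element `∑ q i ⊗ x i` of `M ⊗_R S`. -/
def total {ι : Type*} (q : ι → M) : (ι →₀ S) →+ TensorOver R M S :=
  Finsupp.liftAddHom fun i => tmul R (q i)

@[simp]
theorem total_single {ι : Type*} (q : ι → M) (i : ι) (s : S) :
    total q (Finsupp.single i s) = tmul R (q i) s := by
  simp [total]

theorem map_total {ι : Type*} (q : ι → M) (f : M →ₗ[Rᵐᵒᵖ] N) (g : S →ₗ[R] T) (x : ι →₀ S) :
    map f g (total q x) = total (f ∘ q) (Finsupp.mapRange.addMonoidHom g.toAddMonoidHom x) := by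
  have : (map f g).comp (total q) =
      (total (f ∘ q)).comp (Finsupp.mapRange.addMonoidHom g.toAddMonoidHom) := by
    ext i s
    simp
  exact DFunLike.congr_fun this x

theorem total_id_surjective : Function.Surjective (total (id : M → M) : (M →₀ S) →+ TensorOver R M S) := by
  intro y
  induction y using induction_on with
  | h0 => exact ⟨0, map_zero _⟩
  | ht m s => exact ⟨Finsupp.single m s, by simp⟩
  | ha x y hx hy =>
    obtain ⟨x, rfl⟩ := hx
    obtain ⟨y, rfl⟩ := hy
    exact ⟨x + y, map_add _ _ _⟩

theorem exists_eq_sum (x : TensorOver R M S) :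
    ∃ (n : ℕ) (m : Fin n → M) (s : Fin n → S), x = ∑ i, tmul R (m i) (s i) := by
  obtain ⟨y, rfl⟩ := total_id_surjective x
  refine ⟨y.support.card, fun i => (y.support.equivFin.symm i).1,
    fun i => y (y.support.equivFin.symm i), ?_⟩
  rw [Equiv.sum_comp y.support.equivFin.symm (fun i => tmul R (i.1 : M) (y i.1)),
    Finset.sum_coe_sort y.support (fun i => tmul R i (y i))]
  rfl

/-- The biadditive map `(k, s) ↦ (k i s)_i`. -/
def finsuppTmul (R S : Type u) [Ring R] [AddCommGroup S] [Module R S] (ι : Type u) :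
    (ι →₀ Rᵐᵒᵖ) →+ S →+ (ι →₀ S) :=
  AddMonoidHom.mk' (fun k => AddMonoidHom.mk' (fun s => k.mapRange (fun r => r.unop • s) (by simp))
    (fun s t => by ext; simp)) (fun k l => by ext; simp [add_smul])

@[simp]
theorem finsuppTmul_apply {ι : Type u} (k : ι →₀ Rᵐᵒᵖ) (s : S) (i : ι) :
    finsuppTmul R S ι k s i = (k i).unop • s := rfl

theorem mapRange_finsuppTmul {ι : Type u} (k : ι →₀ Rᵐᵒᵖ) (s : S) (g : S →ₗ[R] T) :
    Finsupp.mapRange.addMonoidHom g.toAddMonoidHom (finsuppTmul R S ι k s) =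
      finsuppTmul R T ι k (g s) := by
  ext i
  simp

theorem total_finsuppTmul {ι : Type u} (q : ι → M) (k : ι →₀ Rᵐᵒᵖ) (s : S) :
    total q (finsuppTmul R S ι k s) = tmul R (Finsupp.linearCombination Rᵐᵒᵖ q k) s := by
  induction k using Finsupp.induction_linear with
  | zero => simp
  | add k l hk hl => simp [hk, hl]
  | single i r =>
    have : finsuppTmul R S ι (Finsupp.single i r) s = Finsupp.single i (r.unop • s) := by
      ext j
      by_cases h : i = j
      · subst h; simp
      · simp [Finsupp.single_eq_of_ne' h]
    rw [this, total_single, Finsupp.linearCombination_single, op_smul_tmul]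

/-- The homomorphism `R^(ι) ⊗_R S → S^(ι)`. -/
def finsuppLeft (R S : Type u) [Ring R] [AddCommGroup S] [Module R S] (ι : Type u) :
    TensorOver R (ι →₀ Rᵐᵒᵖ) S →+ (ι →₀ S) :=
  lift (finsuppTmul R S ι) (fun r k s => by ext; simp [mul_smul])

@[simp]
theorem finsuppLeft_tmul {ι : Type u} (k : ι →₀ Rᵐᵒᵖ) (s : S) :
    finsuppLeft R S ι (tmul R k s) = finsuppTmul R S ι k s := rfl

theorem finsuppLeft_total {ι : Type u} (x : ι →₀ S) :
    finsuppLeft R S ι (total (fun i => Finsupp.single i 1) x) = x := by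
  have : (finsuppLeft R S ι).comp (total (fun i => Finsupp.single i 1)) =
      AddMonoidHom.id _ := by
    ext i s j
    by_cases h : i = j
    · subst h; simp
    · simp [Finsupp.single_eq_of_ne' h]
  exact DFunLike.congr_fun this x

theorem total_finsuppLeft {ι : Type u} (x : TensorOver R (ι →₀ Rᵐᵒᵖ) S) :
    total (fun i => Finsupp.single i 1) (finsuppLeft R S ι x) = x := by
  have : (total (fun i => Finsupp.single i 1)).comp (finsuppLeft R S ι) =
      AddMonoidHom.id (TensorOver R (ι →₀ Rᵐᵒᵖ) S) := by
    refine hom_ext fun k s => ?_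
    have h : Finsupp.linearCombination Rᵐᵒᵖ (fun i : ι => Finsupp.single i (1 : Rᵐᵒᵖ)) k = k := by
      simp [Finsupp.linearCombination_apply]
    simp [total_finsuppTmul, h]
  exact DFunLike.congr_fun this x

/-- The relations that hold in `M ⊗_R S` among families of elements of `S` indexed by `M`. -/
def relations (R M S : Type u) [Ring R] [AddCommGroup M] [Module Rᵐᵒᵖ M]
    [AddCommGroup S] [Module R S] : AddSubgroup (M →₀ S) :=
  AddSubgroup.closure {y | ∃ k s, Finsupp.linearCombination Rᵐᵒᵖ (id : M → M) k = 0 ∧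
    y = finsuppTmul R S M k s}

/-- Right exactness for the free cover R^(M) → M, read through the identification R^(M) ⊗ S ≅ S^(M).
-/
theorem mem_relations_iff {x : M →₀ S} :
    x ∈ relations R M S ↔ total (R := R) (id : M → M) x = 0 := by
  constructor
  · intro hx
    induction hx using AddSubgroup.closure_induction with
    | mem x hx =>
      obtain ⟨k, s, hk, rfl⟩ := hx
      simp [total_finsuppTmul, hk]
    | zero => simp
    | add x y _ _ hx hy => simp [hx, hy]
    | neg x _ hx => simp [hx]
  · intro hx
    have h1 := mem_closure_of_map_eq_zero (S := S)
      (f := Finsupp.linearCombination Rᵐᵒᵖ (id : M → M))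
      (x := total (fun i => Finsupp.single i 1) x)
      (fun m => ⟨Finsupp.single m 1, by simp⟩) (by
        rw [map_total, ← hx]
        congr 1
        · ext; simp
        · ext; simp)
    have h2 := AddSubgroup.mem_map_of_mem (finsuppLeft R S M) h1
    rw [finsuppLeft_total, AddMonoidHom.map_closure] at h2
    refine AddSubgroup.closure_mono ?_ h2
    rintro _ ⟨_, ⟨k, s, hk, rfl⟩, rfl⟩
    exact ⟨k, s, hk, rfl⟩

end TensorOver
end Algebra

/-! ### Mittag-Leffler modules and injectivity on direct products -/

section MittagLeffler

namespace TensorOver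

variable {R M N S T : Type u} [Ring R] [AddCommGroup M] [Module Rᵐᵒᵖ M]
    [AddCommGroup N] [Module Rᵐᵒᵖ N] [AddCommGroup S] [Module R S] [AddCommGroup T] [Module R T]

theorem exists_finset_of_mem_relations {x : M →₀ S} (hx : x ∈ relations R M S) :
    ∃ D : Finset (M →₀ Rᵐᵒᵖ), (∀ k ∈ D, Finsupp.linearCombination Rᵐᵒᵖ (id : M → M) k = 0) ∧
      x ∈ AddSubgroup.closure {y | ∃ k ∈ D, ∃ s, y = finsuppTmul R S M k s} := by
  classical
  induction hx using AddSubgroup.closure_induction with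
  | mem x hx =>
    obtain ⟨k, s, hk, rfl⟩ := hx
    exact ⟨{k}, by simpa using hk, AddSubgroup.subset_closure ⟨k, by simp, s, rfl⟩⟩
  | zero => exact ⟨∅, by simp, zero_mem _⟩
  | add x y _ _ hx hy =>
    obtain ⟨D, hD, hx⟩ := hx
    obtain ⟨E, hE, hy⟩ := hy
    refine ⟨D ∪ E, fun k hk => (Finset.mem_union.1 hk).elim (hD k) (hE k), add_mem ?_ ?_⟩
    · refine AddSubgroup.closure_mono ?_ hx
      rintro _ ⟨k, hk, s, rfl⟩
      exact ⟨k, Finset.mem_union_left _ hk, s, rfl⟩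
    · refine AddSubgroup.closure_mono ?_ hy
      rintro _ ⟨k, hk, s, rfl⟩
      exact ⟨k, Finset.mem_union_right _ hk, s, rfl⟩
  | neg x _ hx =>
    obtain ⟨D, hD, hx⟩ := hx
    exact ⟨D, hD, neg_mem hx⟩

/-- An element of `M ⊗_R S` vanishes already in `Q ⊗_R S` for a finitely presented `Q → M`. -/
theorem exists_finitePresentation {x : M →₀ S} (hx : total (R := R) (id : M → M) x = 0)
    (T₀ : Finset M) :
    ∃ (Q : Type u) (_ : AddCommGroup Q) (_ : Module Rᵐᵒᵖ Q)
      (_ : Module.FinitePresentation Rᵐᵒᵖ Q) (q : M → Q) (h : Q →ₗ[Rᵐᵒᵖ] M),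
      (∀ m ∈ T₀, h (q m) = m) ∧ total (R := R) q x = 0 := by
  classical
  obtain ⟨D, hD, hx'⟩ := exists_finset_of_mem_relations (mem_relations_iff.2 hx)
  clear hx
  -- Q is presented by the generators T and the relations D. T must contain the elements to be
  -- lifted and every element occurring in a relation, so that restricting D to T loses nothing.
  let T : Finset M := T₀ ∪ D.biUnion Finsupp.support
  let ρ : (M →₀ Rᵐᵒᵖ) →ₗ[Rᵐᵒᵖ] (T →₀ Rᵐᵒᵖ) := Finsupp.lsubtypeDomain (T : Set M)
  let K : Submodule Rᵐᵒᵖ (T →₀ Rᵐᵒᵖ) := Submodule.span Rᵐᵒᵖ (D.image ρ : Finset _)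
  let ε : (T →₀ Rᵐᵒᵖ) →ₗ[Rᵐᵒᵖ] M := Finsupp.linearCombination Rᵐᵒᵖ Subtype.val
  have hε : ∀ k : M →₀ Rᵐᵒᵖ, k.support ⊆ T →
      ε (ρ k) = Finsupp.linearCombination Rᵐᵒᵖ (id : M → M) k := by
    intro k hk
    exact Finsupp.sum_subtypeDomain_index (h := fun m (r : Rᵐᵒᵖ) => r • m) (fun m hm => hk hm)
  have hK : K ≤ LinearMap.ker ε := by
    refine Submodule.span_le.2 ?_
    rintro _ hy
    obtain ⟨k, hk, rfl⟩ := Finset.mem_image.1 hy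
    refine (hε k ?_).trans (hD k hk)
    exact (Finset.subset_biUnion_of_mem Finsupp.support hk).trans Finset.subset_union_right
  have hfp : Module.FinitePresentation Rᵐᵒᵖ ((T →₀ Rᵐᵒᵖ) ⧸ K) :=
    Module.finitePresentation_of_surjective K.mkQ K.mkQ_surjective
      (by rw [Submodule.ker_mkQ]; exact ⟨_, rfl⟩)
  -- Elements outside T are sent to zero, since ρ kills their basis vectors.
  let q : M → (T →₀ Rᵐᵒᵖ) ⧸ K := fun m => K.mkQ (ρ (Finsupp.single m 1))
  refine ⟨(T →₀ Rᵐᵒᵖ) ⧸ K, inferInstance, inferInstance, hfp, q, K.liftQ ε hK, ?_, ?_⟩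
  · intro m hm
    refine (hε (Finsupp.single m 1) ?_).trans (by simp)
    refine Finsupp.support_single_subset.trans ?_
    simpa [T] using Or.inl hm
  · have hq : ∀ k, Finsupp.linearCombination Rᵐᵒᵖ q k = K.mkQ (ρ k) := by
      intro k
      have : Finsupp.linearCombination Rᵐᵒᵖ q = K.mkQ ∘ₗ ρ := by
        ext m
        simp [q]
      rw [this]; rfl
    induction hx' using AddSubgroup.closure_induction with
    | mem x hx =>
      obtain ⟨k, hk, s, rfl⟩ := hx
      rw [total_finsuppTmul, hq, (K.mkQ_apply _).trans ((Submodule.Quotient.mk_eq_zero K).2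
        (Submodule.subset_span (Finset.mem_image_of_mem ρ hk)))]
      simp
    | zero => simp
    | add x y _ _ hx hy => simp [hx, hy]
    | neg x _ hx => simp [hx]

theorem mapRange_mem_relations (g : S →ₗ[R] T) {x : M →₀ S} (hx : x ∈ relations R M S) :
    Finsupp.mapRange.addMonoidHom g.toAddMonoidHom x ∈ relations R M T := by
  have := map_total (R := R) (id : M → M) LinearMap.id g x
  rw [mem_relations_iff.1 hx, map_zero] at this
  exact mem_relations_iff.2 this.symm

/-- A given relation is a finite combination of generators and involves only finitely many elements
of S. -/
theorem exists_fg_of_mem_relations {x : M →₀ S} (hx : x ∈ relations R M S) :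
    ∃ (S' : Submodule R S) (_ : S'.FG) (x' : M →₀ S'), x' ∈ relations R M S' ∧
      Finsupp.mapRange.addMonoidHom S'.subtype.toAddMonoidHom x' = x := by
  induction hx using AddSubgroup.closure_induction with
  | mem x hx =>
    obtain ⟨k, s, hk, rfl⟩ := hx
    refine ⟨Submodule.span R {s}, Submodule.fg_span_singleton s,
      finsuppTmul R _ M k ⟨s, Submodule.mem_span_singleton_self s⟩,
      AddSubgroup.subset_closure ⟨k, _, hk, rfl⟩, ?_⟩
    rw [mapRange_finsuppTmul]
    rfl
  | zero => exact ⟨⊥, Submodule.fg_bot, 0, zero_mem _, map_zero _⟩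
  | add x y _ _ hx hy =>
    obtain ⟨A, hA, x, hx, rfl⟩ := hx
    obtain ⟨B, hB, y, hy, rfl⟩ := hy
    let iA := Submodule.inclusion (le_sup_left : A ≤ A ⊔ B)
    let iB := Submodule.inclusion (le_sup_right : B ≤ A ⊔ B)
    refine ⟨A ⊔ B, hA.sup hB, Finsupp.mapRange.addMonoidHom iA.toAddMonoidHom x +
      Finsupp.mapRange.addMonoidHom iB.toAddMonoidHom y, add_mem
      (mapRange_mem_relations iA hx) (mapRange_mem_relations iB hy), ?_⟩
    · ext m
      simp [iA, iB]
  | neg x _ hx =>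
    obtain ⟨A, hA, x, hx, rfl⟩ := hx
    exact ⟨A, hA, -x, neg_mem hx, map_neg _ _⟩

theorem sum_tmul_eq_total {n : ℕ} (m : Fin n → M) (s : Fin n → S) :
    ∑ i, tmul R (m i) (s i) = total (R := R) id (∑ i, Finsupp.single (m i) (s i)) := by
  simp

/-- Reduces arbitrary coefficient modules to the quotients of R^l, which form a set and can
therefore index a single product. -/
theorem exists_fg_of_sum_tmul_eq_zero {n : ℕ} {m : Fin n → M} {s : Fin n → S}
    (h : ∑ i, tmul R (m i) (s i) = 0) :
    ∃ (l : ℕ) (K : Submodule R (Fin l → R)) (t : Fin n → (Fin l → R) ⧸ K)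
      (φ : ((Fin l → R) ⧸ K) →ₗ[R] S),
      (∀ i, φ (t i) = s i) ∧ ∑ i, tmul R (m i) (t i) = 0 := by
  rw [sum_tmul_eq_total] at h
  obtain ⟨A, hA, x, hx, hxs⟩ := exists_fg_of_mem_relations (mem_relations_iff.2 h)
  -- The submodule A witnesses the relation but need not contain all the s i.
  let B := A ⊔ Submodule.span R (Set.range s)
  have hB : B.FG := hA.sup (Submodule.fg_span (Set.finite_range s))
  have hs : ∀ i, s i ∈ B := fun i =>
    (le_sup_right : _ ≤ B) (Submodule.subset_span (Set.mem_range_self i))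
  let iA := Submodule.inclusion (le_sup_left : A ≤ B)
  have hxB : Finsupp.mapRange.addMonoidHom iA.toAddMonoidHom x =
      ∑ i, Finsupp.single (m i) (⟨s i, hs i⟩ : B) := by
    have hinj : Function.Injective
        (Finsupp.mapRange.addMonoidHom (ι := M) B.subtype.toAddMonoidHom) :=
      Finsupp.mapRange_injective _ (map_zero _) Subtype.val_injective
    apply hinj
    rw [map_sum]
    simp only [Finsupp.mapRange.addMonoidHom_apply, Finsupp.mapRange_single]
    refine Eq.trans ?_ hxs
    ext p
    simp [iA]
  have hsum : ∑ i, tmul R (m i) (⟨s i, hs i⟩ : B) = 0 := by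
    rw [sum_tmul_eq_total, ← hxB]
    exact mem_relations_iff.1 (mapRange_mem_relations iA hx)
  have : Module.Finite R B := Module.Finite.iff_fg.2 hB
  obtain ⟨l, π, hπ⟩ := Module.Finite.exists_fin' R B
  let e := π.quotKerEquivOfSurjective hπ
  refine ⟨l, LinearMap.ker π, fun i => e.symm ⟨s i, hs i⟩, B.subtype ∘ₗ e.toLinearMap,
    fun i => by simp, ?_⟩
  have := congrArg (map (LinearMap.id : M →ₗ[Rᵐᵒᵖ] M) e.symm.toLinearMap) hsum
  simpa using this

/-- The canonical map `M ⊗_R ∏ S i → ∏ M ⊗_R S i` is injective for all families. -/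
def InjectiveOnProducts (R M : Type u) [Ring R] [AddCommGroup M] [Module Rᵐᵒᵖ M] : Prop :=
  ∀ (I : Type u) (S : I → Type u) [∀ i, AddCommGroup (S i)] [∀ i, Module R (S i)]
    (x : TensorOver R M (∀ i, S i)),
    (∀ i, map (LinearMap.id : M →ₗ[Rᵐᵒᵖ] M) (LinearMap.proj i : (∀ i, S i) →ₗ[R] S i) x = 0) →
      x = 0

theorem finsuppLeft_injective {ι : Type u} : Function.Injective (finsuppLeft R S ι) :=
  Function.LeftInverse.injective total_finsuppLeft

theorem finsuppLeft_map {ι : Type u} (g : S →ₗ[R] T) (x : TensorOver R (ι →₀ Rᵐᵒᵖ) S) :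
    finsuppLeft R T ι (map LinearMap.id g x) =
      Finsupp.mapRange.addMonoidHom g.toAddMonoidHom (finsuppLeft R S ι x) := by
  have : (finsuppLeft R T ι).comp (map LinearMap.id g) =
      (Finsupp.mapRange.addMonoidHom g.toAddMonoidHom).comp (finsuppLeft R S ι) :=
    hom_ext fun k s => (mapRange_finsuppTmul k s g).symm
  exact DFunLike.congr_fun this x

/-- Under R^(ι) ⊗ S ≅ S^(ι), vanishing is checked coordinate by coordinate. -/
theorem injectiveOnProducts_finsupp (ι : Type u) : InjectiveOnProducts R (ι →₀ Rᵐᵒᵖ) := by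
  intro I S _ _ x hx
  apply finsuppLeft_injective
  ext p i
  have := congrArg (finsuppLeft R (S i) ι) (hx i)
  rw [finsuppLeft_map] at this
  simpa using DFunLike.congr_fun this p

theorem exists_sum_of_mem_closure {c : ℕ} (k : Fin c → N) {x : TensorOver R N S}
    (hx : x ∈ AddSubgroup.closure
      {y | ∃ l s, l ∈ Submodule.span Rᵐᵒᵖ (Set.range k) ∧ y = tmul R l s}) :
    ∃ t : Fin c → S, x = ∑ i, tmul R (k i) (t i) := by
  induction hx using AddSubgroup.closure_induction with
  | mem x hx =>
    obtain ⟨l, s, hl, rfl⟩ := hx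
    obtain ⟨a, rfl⟩ := (Submodule.mem_span_range_iff_exists_fun _).1 hl
    refine ⟨fun i => (a i).unop • s, ?_⟩
    simp [op_smul_tmul]
  | zero => exact ⟨0, by simp⟩
  | add x y _ _ hx hy =>
    obtain ⟨t, rfl⟩ := hx
    obtain ⟨t', rfl⟩ := hy
    exact ⟨t + t', by simp [Finset.sum_add_distrib]⟩
  | neg x _ hx =>
    obtain ⟨t, rfl⟩ := hx
    exact ⟨-t, by simp⟩

/-- A diagram chase in a finite presentation. Each component of a lift to the free cover is a
combination of the same finitely many relations, so the coefficients assemble into elements of the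
product. -/
theorem injectiveOnProducts_of_finitePresentation [Module.FinitePresentation Rᵐᵒᵖ M] :
    InjectiveOnProducts R M := by
  classical
  intro I S _ _ x hx
  obtain ⟨T, hT, hrel⟩ := Module.FinitePresentation.out (R := Rᵐᵒᵖ) (M := M)
  let ε : (T →₀ Rᵐᵒᵖ) →ₗ[Rᵐᵒᵖ] M := Finsupp.linearCombination Rᵐᵒᵖ Subtype.val
  have hε : Function.Surjective ε := by
    rw [← LinearMap.range_eq_top, Finsupp.range_linearCombination, Subtype.range_coe]
    exact hT
  obtain ⟨c, k, hk⟩ := Submodule.fg_iff_exists_fin_generating_family.1 hrel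
  obtain ⟨y, rfl⟩ := map_surjective hε x
  have ht : ∀ i, ∃ t : Fin c → S i,
      map LinearMap.id (LinearMap.proj i) y = ∑ j, tmul R (k j) (t j) := by
    intro i
    refine exists_sum_of_mem_closure k ?_
    rw [hk]
    refine mem_closure_of_map_eq_zero hε ?_
    rw [← hx i, map_map, map_map]
    rfl
  choose t ht using ht
  have hy : y = ∑ j, tmul R (k j) (fun i => t i j) := by
    rw [← sub_eq_zero]
    refine injectiveOnProducts_finsupp T I S _ fun i => ?_
    rw [map_sub, ht i, map_sum, sub_eq_zero]
    rfl
  rw [hy, map_sum]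
  refine Finset.sum_eq_zero fun j _ => ?_
  have : ε (k j) = 0 := by
    have : k j ∈ LinearMap.ker ε := by
      change k j ∈ LinearMap.ker (Finsupp.linearCombination Rᵐᵒᵖ Subtype.val)
      rw [← hk]
      exact Submodule.subset_span (Set.mem_range_self j)
    exact this
  rw [map_tmul, this, map_zero, AddMonoidHom.zero_apply]

/-- Lift the tensor to a finite free module mapping to M. Equality of kernels, over the product and
over each factor, moves the question to a finitely presented Q. -/
theorem injectiveOnProducts_of_isMittagLeffler (h : IsMittagLeffler R M) :
    InjectiveOnProducts R M := by
  intro I S _ _ x hx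
  obtain ⟨n, m, s, rfl⟩ := exists_eq_sum x
  let f : (Fin n → Rᵐᵒᵖ) →ₗ[Rᵐᵒᵖ] M := Fintype.linearCombination Rᵐᵒᵖ m
  obtain ⟨Q, _, _, _, g, hg⟩ := h (Fin n → Rᵐᵒᵖ) f
  let y : TensorOver R (Fin n → Rᵐᵒᵖ) (∀ i, S i) := ∑ i, tmul R (Pi.single i 1) (s i)
  have hy : map f LinearMap.id y = ∑ i, tmul R (m i) (s i) := by
    simp [y, f, Fintype.linearCombination_apply_single]
  rw [← hy] at hx ⊢
  change y ∈ (map f LinearMap.id).ker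
  rw [hg]
  refine injectiveOnProducts_of_finitePresentation I S _ fun i => ?_
  have hi : map LinearMap.id (LinearMap.proj i) y ∈
      (map f (LinearMap.id : S i →ₗ[R] S i)).ker := by
    rw [AddMonoidHom.mem_ker, ← hx i, map_map, map_map]
    rfl
  rw [hg, AddMonoidHom.mem_ker] at hi
  rw [← hi, map_map, map_map]
  rfl

/-- The relations combine into one tensor over ∏ V a, which vanishes by injectivity; one Q killing
it kills every component. -/
theorem exists_finitePresentation_of_family (h : InjectiveOnProducts R M) {n : ℕ} (m : Fin n → M)
    {I : Type u} (V : I → Type u) [∀ a, AddCommGroup (V a)] [∀ a, Module R (V a)]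
    (v : ∀ a, Fin n → V a) (hv : ∀ a, ∑ i, tmul R (m i) (v a i) = 0) :
    ∃ (Q : Type u) (_ : AddCommGroup Q) (_ : Module Rᵐᵒᵖ Q)
      (_ : Module.FinitePresentation Rᵐᵒᵖ Q) (q : Fin n → Q) (e : Q →ₗ[Rᵐᵒᵖ] M),
      (∀ i, e (q i) = m i) ∧ ∀ a, ∑ i, tmul R (q i) (v a i) = 0 := by
  classical
  have hw : ∑ i, tmul R (m i) (fun a => v a i) = 0 := by
    refine h I V _ fun a => ?_
    rw [map_sum]
    exact hv a
  rw [sum_tmul_eq_total] at hw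
  obtain ⟨Q, _, _, hQ, q, e, heq, hq⟩ := exists_finitePresentation hw (Finset.univ.image m)
  refine ⟨Q, inferInstance, inferInstance, hQ, fun i => q (m i), e,
    fun i => heq _ (Finset.mem_image_of_mem _ (Finset.mem_univ i)), fun a => ?_⟩
  have := congrArg (map (LinearMap.id : Q →ₗ[Rᵐᵒᵖ] Q)
    (LinearMap.proj a : (∀ a, V a) →ₗ[R] V a)) hq
  simpa using this

/-- Choose Q for the images in M of generators of P, using all their relations over quotients of R^l
at once. The lifted tuple in Q then satisfies the same relations over every left module. -/
theorem isMittagLeffler_of_injectiveOnProducts (h : InjectiveOnProducts R M) :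
    IsMittagLeffler R M := by
  classical
  intro P _ _ _ f
  obtain ⟨n, π, hπ⟩ := Module.Finite.exists_fin' Rᵐᵒᵖ P
  let p : Fin n → P := fun i => π (Pi.single i 1)
  let m : Fin n → M := fun i => f (p i)
  obtain ⟨Q, _, _, hQ, q, e, hem, hqv⟩ := exists_finitePresentation_of_family h m
    (I := Σ l : ℕ, Σ K : Submodule R (Fin l → R),
      {t : Fin n → (Fin l → R) ⧸ K // ∑ i, tmul R (m i) (t i) = 0})
    (fun a => (Fin a.1 → R) ⧸ a.2.1) (fun a => a.2.2.1) (fun a => a.2.2.2)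
  have key : ∀ (S : Type u) [AddCommGroup S] [Module R S] (s : Fin n → S),
      ∑ i, tmul R (m i) (s i) = 0 ↔ ∑ i, tmul R (q i) (s i) = 0 := by
    intro S _ _ s
    constructor
    · intro hs
      obtain ⟨l, K, t, φ, hφ, ht⟩ := exists_fg_of_sum_tmul_eq_zero hs
      have := congrArg (map (LinearMap.id : Q →ₗ[Rᵐᵒᵖ] Q) φ) (hqv ⟨l, K, t, ht⟩)
      simpa [hφ] using this
    · intro hs
      have := congrArg (map e (LinearMap.id : S →ₗ[R] S)) hs
      simpa [hem] using this
  let γ : (Fin n → Rᵐᵒᵖ) →ₗ[Rᵐᵒᵖ] Q := Fintype.linearCombination Rᵐᵒᵖ fun i => q i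
  have hπf : ∀ k, f (π k) = ∑ i, k i • m i := by
    have : f ∘ₗ π = Fintype.linearCombination Rᵐᵒᵖ m := by
      refine LinearMap.pi_ext' fun i => LinearMap.ext_ring ?_
      simp [m, p, Fintype.linearCombination_apply_single]
    intro k
    exact DFunLike.congr_fun this k
  -- `key` with S = R, combined with Q ⊗ R → Q, turns a linear relation among the generators of P
  -- into one among the q i; hence g is well defined on P.
  have hγ : LinearMap.ker π ≤ LinearMap.ker γ := by
    intro k hk
    have h0 : ∑ i, tmul R (m i) (k i).unop = 0 := by
      have h1 : ∑ i, k i • m i = 0 := by rw [← hπf, LinearMap.mem_ker.1 hk, map_zero]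
      have h2 := congrArg (fun z => tmul R z (1 : R)) h1
      simpa [op_smul_tmul] using h2
    have h3 := congrArg toModule ((key R _).1 h0)
    rw [map_sum, map_zero] at h3
    exact h3
  let g : P →ₗ[Rᵐᵒᵖ] Q :=
    (LinearMap.ker π).liftQ γ hγ ∘ₗ (π.quotKerEquivOfSurjective hπ).symm.toLinearMap
  have hg : ∀ i, g (p i) = q i := by
    intro i
    have : (π.quotKerEquivOfSurjective hπ).symm (π (Pi.single i 1)) =
        (LinearMap.ker π).mkQ (Pi.single i 1) := by
      rw [LinearEquiv.symm_apply_eq]; rfl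
    simp only [g, p, LinearMap.comp_apply, LinearEquiv.coe_coe, this]
    simp [γ, Fintype.linearCombination_apply_single]
  refine ⟨Q, inferInstance, inferInstance, hQ, g, fun S _ _ => ?_⟩
  ext x
  obtain ⟨s, rfl⟩ : ∃ s : Fin n → S, x = ∑ i, tmul R (p i) (s i) := by
    refine exists_sum_of_mem_closure p ?_
    have htop : Submodule.span Rᵐᵒᵖ (Set.range p) = ⊤ := by
      have : Set.range p = π '' Set.range (Pi.basisFun Rᵐᵒᵖ (Fin n)) := by
        rw [← Set.range_comp]
        congr 1
        ext i
        simp [p]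
      rw [this, ← Submodule.map_span, Module.Basis.span_eq, Submodule.map_top,
        LinearMap.range_eq_top.2 hπ]
    induction x using induction_on with
    | h0 => exact zero_mem _
    | ht l s => exact AddSubgroup.subset_closure ⟨l, s, by rw [htop]; trivial, rfl⟩
    | ha x y hx hy => exact add_mem hx hy
  simp only [AddMonoidHom.mem_ker, map_sum, map_tmul, hg]
  exact key S s

theorem isMittagLeffler_iff_injectiveOnProducts :
    IsMittagLeffler R M ↔ InjectiveOnProducts R M :=
  ⟨injectiveOnProducts_of_isMittagLeffler, isMittagLeffler_of_injectiveOnProducts⟩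

end TensorOver
end MittagLeffler

/-! ### Powers of 𝓡 and their morphisms to 𝓜 -/

noncomputable section Functors

open TensorOver

variable {R : Type u} [Ring R] {M : Type u} [AddCommGroup M] [Module Rᵐᵒᵖ M]

theorem AddCommGrpCat.nonempty_isLimit_of_bijective {J : Type*} {K : Discrete J ⥤ AddCommGrpCat.{u}}
    (c : Cone K) (h : Function.Bijective fun (x : c.pt) (j : J) => (c.π.app ⟨j⟩).hom x) :
    Nonempty (IsLimit c) := by
  let φ : c.pt →+ ∀ j : J, K.obj ⟨j⟩ := AddMonoidHom.pi fun j => (c.π.app ⟨j⟩).hom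
  let e : c.pt ≃+ ∀ j : J, K.obj ⟨j⟩ := AddEquiv.ofBijective φ h
  refine ⟨{
    lift s := AddCommGrpCat.ofHom (e.symm.toAddMonoidHom.comp
      (AddMonoidHom.pi fun j : J => (s.π.app ⟨j⟩).hom))
    fac := ?_
    uniq := ?_ }⟩
  · rintro s ⟨j⟩
    ext x
    exact congrFun (e.apply_symm_apply fun j => (s.π.app ⟨j⟩).hom x) j
  · intro s m hm
    ext x
    change _ = e.symm _
    rw [AddEquiv.eq_symm_apply]
    funext j
    exact congrArg (fun f => f.hom x) (hm ⟨j⟩)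

/-- The functor `S ↦ S^I`. -/
def powerFunctor (R : Type u) [Ring R] (I : Type) : ModuleCat.{u} R ⥤ AddCommGrpCat.{u} where
  obj S := AddCommGrpCat.of (I → S)
  map g := AddCommGrpCat.ofHom
    (AddMonoidHom.pi fun i => g.hom.toAddMonoidHom.comp (Pi.evalAddMonoidHom _ i))

/-- The projection `S^I → S ≅ R ⊗_R S`. -/
def powerFunctorProj (R : Type u) [Ring R] {I : Type} (i : I) :
    powerFunctor R I ⟶ quasiCoherent R R where
  app S := AddCommGrpCat.ofHom ((tmul R (1 : R)).comp (Pi.evalAddMonoidHom (fun _ : I => (S : Type u)) i))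

theorem tmul_one_bijective {S : Type u} [AddCommGroup S] [Module R S] :
    Function.Bijective (tmul R (1 : R) : S → TensorOver R R S) := by
  let μ : TensorOver R R S →+ S := lift (AddMonoidHom.mk' (fun r => AddMonoidHom.mk'
    (fun s => r • s) (fun s t => by simp)) (fun m n => by ext; simp [add_smul]))
    (fun r m s => by simp [mul_smul])
  refine Function.bijective_iff_has_inverse.2 ⟨μ, fun s => one_smul R s, fun x => ?_⟩
  have : (tmul R (1 : R)).comp μ = AddMonoidHom.id (TensorOver R R S) := by
    refine hom_ext fun r s => ?_
    change tmul R (1 : R) (r • s) = tmul R r s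
    rw [← TensorOver.smul_tmul]
    simp
  exact DFunLike.congr_fun this x

theorem nonempty_isLimit_powerFunctor (R : Type u) [Ring R] (I : Type) :
    Nonempty (IsLimit (Fan.mk (powerFunctor R I) fun i : I => powerFunctorProj R i)) := by
  refine ⟨evaluationJointlyReflectsLimits _ fun S =>
    (AddCommGrpCat.nonempty_isLimit_of_bijective _ ?_).some⟩
  constructor
  · intro s t h
    funext i
    exact tmul_one_bijective.1 (congrFun h i)
  · intro y
    choose s hs using fun i => tmul_one_bijective.2 (y i)
    exact ⟨s, funext hs⟩

/-- `∏_I 𝓡` is the functor `S ↦ S^I`. -/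
def powerFunctorIso (R : Type u) [Ring R] (I : Type) [Countable I] :
    powerFunctor R I ≅ ringFunctorPower R I :=
  (nonempty_isLimit_powerFunctor R I).some.conePointUniqueUpToIso (limit.isLimit _)

/-- The morphism `s ↦ ∑ m i ⊗ s i` from `∏_I 𝓡` to `𝓜`. -/
def powerFunctorHom {I : Type} (m : I →₀ M) : powerFunctor R I ⟶ quasiCoherent R M where
  app S := AddCommGrpCat.ofHom (AddMonoidHom.mk'
    (fun s : I → S => m.sum fun i p => tmul R p (s i)) (fun s t => by simp [Finsupp.sum_add]))
  naturality S T g := by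
    ext s
    change (m.sum fun i p => tmul R p (g.hom (s i))) =
      TensorOver.map LinearMap.id g.hom (m.sum fun i p => tmul R p (s i))
    simp [Finsupp.sum]

/-- Yoneda: the family e of basis vectors of R^(I) is universal in S^I, so f is determined by f(e) ∈
M ⊗ R^(I) ≅ M^(I). This forces finite support even for infinite I. -/
theorem exists_eq_powerFunctorHom {I : Type} (f : powerFunctor R I ⟶ quasiCoherent R M) :
    ∃ m : I →₀ M, f = powerFunctorHom m := by
  classical
  let E : ModuleCat.{u} R := ModuleCat.of R (I →₀ R)
  let e : I → E := fun i => Finsupp.single i (1 : R)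
  have key : ∀ y : TensorOver R M E, ∃ m : I →₀ M, y = m.sum fun i p => tmul R p (e i) := by
    intro y
    induction y using TensorOver.induction_on with
    | h0 => exact ⟨0, by simp⟩
    | ht p r =>
      refine ⟨r.mapRange (fun a : R => MulOpposite.op a • p) (by simp), ?_⟩
      rw [Finsupp.sum_mapRange_index (by simp)]
      have : (r : I →₀ R) = Finsupp.sum r fun i a => a • Finsupp.single i (1 : R) := by
        simp
      refine (congrArg (tmul R p) this).trans ?_
      exact (map_finsuppSum _ _ _).trans
        (Finset.sum_congr rfl fun i _ => (TensorOver.smul_tmul _ _ _).symm)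
    | ha x y hx hy =>
      obtain ⟨m, rfl⟩ := hx
      obtain ⟨n, rfl⟩ := hy
      exact ⟨m + n, by rw [Finsupp.sum_add_index' (by simp) (by simp)]⟩
  obtain ⟨m, hm⟩ := key ((f.app E).hom e)
  refine ⟨m, ?_⟩
  ext S s
  let φ : E ⟶ S := ModuleCat.ofHom (Finsupp.linearCombination R (s : I → S))
  have hs : ((powerFunctor R I).map φ).hom e = s := by
    funext i
    exact (Finsupp.linearCombination_single R (1 : R) i).trans (one_smul R _)
  have hn := congrArg (fun g => g.hom e) (f.naturality φ)
  change (f.app S).hom (((powerFunctor R I).map φ).hom e) =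
    TensorOver.map LinearMap.id φ.hom ((f.app E).hom e) at hn
  have hn' := congrArg (fun g => g.hom e) ((powerFunctorHom (R := R) m).naturality φ)
  change ((powerFunctorHom m).app S).hom (((powerFunctor R I).map φ).hom e) =
    TensorOver.map LinearMap.id φ.hom (((powerFunctorHom m).app E).hom e) at hn'
  rw [hs] at hn hn'
  change (f.app S).hom s = ((powerFunctorHom m).app S).hom s
  rw [hn, hn', hm]
  rfl

end Functors

/-! ### Functors that are both quotients of S^I and subfunctors of M ⊗ S -/

section Images

open TensorOver

variable {R : Type u} [Ring R] {M : Type u} [AddCommGroup M] [Module Rᵐᵒᵖ M]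

theorem TensorOver.map_add_right {S T : Type u} [AddCommGroup S] [Module R S] [AddCommGroup T]
    [Module R T] {N : Type u} [AddCommGroup N] [Module Rᵐᵒᵖ N] (f : M →ₗ[Rᵐᵒᵖ] N) (g h : S →ₗ[R] T)
    (x : TensorOver R M S) :
    TensorOver.map f (g + h) x = TensorOver.map f g x + TensorOver.map f h x := by
  have : TensorOver.map f (g + h) = TensorOver.map f g + TensorOver.map f h :=
    hom_ext fun m s => by simp
  exact DFunLike.congr_fun this x

theorem AddCommGrpCat.naturality_apply {C : Type*} [Category C] {F G : C ⥤ AddCommGrpCat.{u}}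
    (η : F ⟶ G) {S T : C} (g : S ⟶ T) (x : F.obj S) :
    (η.app T).hom ((F.map g).hom x) = (G.map g).hom ((η.app S).hom x) :=
  congrArg (fun f => f.hom x) (η.naturality g)

variable {F : ModuleCat.{u} R ⥤ AddCommGrpCat.{u}} (ι : F ⟶ quasiCoherent R M)
  (hι : ∀ S, Function.Injective (ι.app S).hom)

include hι in
theorem additive_of_injective : F.Additive where
  map_add {S T f g} := by
    ext x
    apply hι
    change (ι.app T).hom ((F.map (f + g)).hom x) =
      (ι.app T).hom ((F.map f).hom x + (F.map g).hom x)
    rw [map_add]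
    simp only [AddCommGrpCat.naturality_apply]
    exact TensorOver.map_add_right _ _ _ _

include hι in
theorem preservesDirectProducts_of_injectiveOnProducts (h : InjectiveOnProducts R M) {I : Type}
    (e : powerFunctor R I ⟶ F) (he : ∀ S, Function.Surjective (e.app S).hom) :
    PreservesDirectProducts F := by
  intro J
  have : ∀ S : J → ModuleCat.{u} R, PreservesLimit (Discrete.functor S) F := by
    intro S
    refine preservesLimit_of_preserves_limit_cone (ModuleCat.productConeIsLimit S)
      (AddCommGrpCat.nonempty_isLimit_of_bijective _ ⟨?_, ?_⟩).some
    · let φ : F.obj (ModuleCat.of R (∀ j, S j)) →+ ∀ j, F.obj (S j) := AddMonoidHom.pi fun j =>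
        (F.map (ModuleCat.ofHom (LinearMap.proj j : (∀ j, S j) →ₗ[R] S j))).hom
      refine (injective_iff_map_eq_zero φ).2 fun x hx => ?_
      apply hι
      rw [map_zero]
      refine h J (fun j => S j) _ fun j => ?_
      have := congrArg (ι.app (S j)).hom (congrFun hx j)
      refine Eq.trans ?_ (this.trans (map_zero _))
      exact (AddCommGrpCat.naturality_apply ι _ _).symm
    · intro y
      -- Lifts chosen factor by factor form one element of (∏ S j)^I.
      choose s hs using fun j => he (S j) (y j)
      refine ⟨(e.app (ModuleCat.of R (∀ j, S j))).hom fun i j => s j i, funext fun j => ?_⟩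
      exact (AddCommGrpCat.naturality_apply e _ _).symm.trans (hs j)
  exact preservesLimitsOfShape_of_discrete F

/-- The tensor is the image under ι of e(s) ∈ F(∏ S j). The components of e(s) vanish because ι is
injective, hence so does e(s). -/
theorem eq_zero_of_preservesDirectProducts (hF : PreservesDirectProducts F) {I : Type}
    (e : powerFunctor R I ⟶ F) (m : I →₀ M) (hm : e ≫ ι = powerFunctorHom m)
    (hι : ∀ S, Function.Injective (ι.app S).hom)
    (J : Type u) (S : J → Type u) [∀ j, AddCommGroup (S j)] [∀ j, Module R (S j)]
    (s : I → ∀ j, S j) (hs : ∀ j, (m.sum fun i p => tmul R p (s i j)) = 0) :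
    (m.sum fun i p => tmul R p (s i)) = 0 := by
  have := hF J
  let P : ModuleCat.{u} R := ModuleCat.of R (∀ j, S j)
  have hem : ∀ (T : ModuleCat.{u} R) (t : I → T),
      (ι.app T).hom ((e.app T).hom t) = m.sum fun i p => tmul R p (t i) := by
    intro T t
    exact congrArg (fun f => (f.app T).hom t) hm
  have h0 : (e.app P).hom s = 0 := by
    refine Concrete.isLimit_ext _ (isLimitOfPreserves F
      (ModuleCat.productConeIsLimit fun j => ModuleCat.of R (S j))) _ _ ?_
    rintro ⟨j⟩
    refine Eq.trans ?_ (map_zero _).symm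
    apply hι
    rw [map_zero]
    refine Eq.trans ?_ (hs j)
    refine Eq.trans ?_ (hem (ModuleCat.of R (S j)) fun i => s i j)
    exact congrArg (ι.app (ModuleCat.of R (S j))).hom
      (AddCommGrpCat.naturality_apply e
        (ModuleCat.ofHom (LinearMap.proj j : (∀ j, S j) →ₗ[R] S j)) s).symm
  exact (hem P s).symm.trans ((congrArg _ h0).trans (map_zero _))

/-! ### Tensors and relations in direct limits -/

section DirectLimits

theorem ModuleCat.ι_map_apply {I : Type u} [Preorder I] {K : I ⥤ ModuleCat.{u} R} {c : Cocone K}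
    {j k : I} (f : j ⟶ k) (x : K.obj j) :
    (c.ι.app k).hom ((K.map f).hom x) = (c.ι.app j).hom x :=
  congrArg (fun g => g.hom x) (c.w f)

variable {I : Type u} [Preorder I] [IsDirectedOrder I] [Nonempty I] {K : I ⥤ ModuleCat.{u} R}
  {c : Cocone K} (hc : IsColimit c)

include hc in
theorem exists_common_stage {α : Type*} (A : Finset α) (s : α → c.pt) :
    ∃ (j : I) (t : α → K.obj j), ∀ a ∈ A, (c.ι.app j).hom (t a) = s a := by
  classical
  choose j t ht using fun a => Concrete.isColimit_exists_rep K hc (s a)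
  obtain ⟨k, hk⟩ := (A.image j).exists_le
  refine ⟨k, fun a => if h : j a ≤ k then (K.map (homOfLE h)).hom (t a) else 0, fun a ha => ?_⟩
  have h : j a ≤ k := hk _ (Finset.mem_image_of_mem j ha)
  simp only [h, dif_pos]
  rw [ModuleCat.ι_map_apply]
  exact ht a

include hc in
theorem exists_mapRange_eq_zero {α : Type*} {j : I} (z : α →₀ K.obj j)
    (hz : Finsupp.mapRange.addMonoidHom (c.ι.app j).hom.toAddMonoidHom z = 0) :
    ∃ (k : I) (f : j ⟶ k), Finsupp.mapRange.addMonoidHom (K.map f).hom.toAddMonoidHom z = 0 := by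
  classical
  have : ∀ a, ∃ (k : I) (f : j ⟶ k), (K.map f).hom (z a) = 0 := by
    intro a
    have ha : (c.ι.app j).hom (z a) = (c.ι.app j).hom 0 := by
      rw [map_zero]
      exact DFunLike.congr_fun hz a
    obtain ⟨k, f, g, h⟩ := Concrete.isColimit_exists_of_rep_eq K hc _ _ ha
    exact ⟨k, f, h.trans (map_zero _)⟩
  choose k f hf using this
  obtain ⟨l, hl⟩ := (insert j (z.support.image k)).exists_le
  refine ⟨l, homOfLE (hl j (Finset.mem_insert_self _ _)), ?_⟩
  ext a
  by_cases ha : a ∈ z.support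
  · have hkl : k a ≤ l := hl _ (Finset.mem_insert_of_mem (Finset.mem_image_of_mem k ha))
    have : homOfLE (hl j (Finset.mem_insert_self _ _)) = f a ≫ homOfLE hkl := rfl
    rw [this, K.map_comp]
    change (K.map (homOfLE hkl)).hom ((K.map (f a)).hom (z a)) = 0
    rw [hf, map_zero]
  · simp [Finsupp.notMem_support_iff.1 ha]

include hc in
theorem exists_mem_relations {x : M →₀ c.pt} (hx : x ∈ relations R M c.pt) :
    ∃ (j : I) (y : M →₀ K.obj j), y ∈ relations R M (K.obj j) ∧
      Finsupp.mapRange.addMonoidHom (c.ι.app j).hom.toAddMonoidHom y = x := by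
  induction hx using AddSubgroup.closure_induction with
  | mem x hx =>
    obtain ⟨k, s, hk, rfl⟩ := hx
    obtain ⟨j, t, rfl⟩ := Concrete.isColimit_exists_rep K hc s
    exact ⟨j, finsuppTmul R _ M k t, AddSubgroup.subset_closure ⟨k, t, hk, rfl⟩,
      mapRange_finsuppTmul k t (c.ι.app j).hom⟩
  | zero => exact ⟨Classical.arbitrary I, 0, zero_mem _, map_zero _⟩
  | add x y _ _ hx hy =>
    obtain ⟨j, x, hx, rfl⟩ := hx
    obtain ⟨k, y, hy, rfl⟩ := hy
    obtain ⟨l, hj, hk⟩ := exists_ge_ge j k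
    refine ⟨l, _, add_mem (mapRange_mem_relations (K.map (homOfLE hj)).hom hx)
      (mapRange_mem_relations (K.map (homOfLE hk)).hom hy), ?_⟩
    rw [map_add]
    congr 1
    · ext p
      exact ModuleCat.ι_map_apply (homOfLE hj) (x p)
    · ext p
      exact ModuleCat.ι_map_apply (homOfLE hk) (y p)
  | neg x _ hx =>
    obtain ⟨j, y, hy, rfl⟩ := hx
    exact ⟨j, -y, neg_mem hy, map_neg _ _⟩

include hc in
-- The relation over the limit descends to a relation y at some stage; x and y agree in the limit,
-- hence, having finite support, at a later stage.
theorem exists_map_eq_zero {j : I} (x : TensorOver R M (K.obj j))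
    (hx : TensorOver.map (LinearMap.id : M →ₗ[Rᵐᵒᵖ] M) (c.ι.app j).hom x = 0) :
    ∃ (k : I) (f : j ⟶ k),
      TensorOver.map (LinearMap.id : M →ₗ[Rᵐᵒᵖ] M) (K.map f).hom x = 0 := by
  obtain ⟨x, rfl⟩ := total_id_surjective x
  rw [map_total] at hx
  obtain ⟨k, y, hy, hyx⟩ := exists_mem_relations hc (mem_relations_iff.2 hx)
  obtain ⟨l, hj, hk⟩ := exists_ge_ge j k
  let x' := Finsupp.mapRange.addMonoidHom (K.map (homOfLE hj)).hom.toAddMonoidHom x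
  let y' := Finsupp.mapRange.addMonoidHom (K.map (homOfLE hk)).hom.toAddMonoidHom y
  obtain ⟨n, f, hn⟩ := exists_mapRange_eq_zero hc (x' - y') (by
    rw [map_sub, sub_eq_zero]
    ext p
    refine (ModuleCat.ι_map_apply (homOfLE hj) (x p)).trans
      (Eq.trans ?_ (ModuleCat.ι_map_apply (homOfLE hk) (y p)).symm)
    exact (DFunLike.congr_fun hyx p).symm)
  refine ⟨n, homOfLE hj ≫ f, ?_⟩
  rw [map_total]
  refine mem_relations_iff.1 ?_
  rw [map_sub, sub_eq_zero] at hn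
  have h1 : Finsupp.mapRange.addMonoidHom (K.map (homOfLE hj ≫ f)).hom.toAddMonoidHom x =
      Finsupp.mapRange.addMonoidHom (K.map f).hom.toAddMonoidHom x' := by
    rw [K.map_comp]
    ext p
    rfl
  rw [h1, hn]
  exact mapRange_mem_relations _ (mapRange_mem_relations _ hy)

end DirectLimits

include hι in
-- S^I need not commute with direct limits for infinite I, but only the coordinates in the finite
-- support of m affect e(s), and these lift to a common stage.
theorem preservesDirectLimits_of_injective {I : Type} (e : powerFunctor R I ⟶ F)
    (he : ∀ S, Function.Surjective (e.app S).hom) : PreservesDirectLimits F := by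
  intro J _ _ _
  obtain ⟨m, hm⟩ := exists_eq_powerFunctorHom (e ≫ ι)
  have hem : ∀ (T : ModuleCat.{u} R) (t : I → T),
      (ι.app T).hom ((e.app T).hom t) = m.sum fun i p => tmul R p (t i) := by
    intro T t
    exact congrArg (fun f => (f.app T).hom t) hm
  refine ⟨fun {K} => ⟨fun {c} hc => ?_⟩⟩
  -- Filtered colimits of abelian groups can be recognized on underlying sets: every element comes
  -- from a stage, and equal images agree at a later stage.
  have : ReflectsColimitsOfShape J (forget AddCommGrpCat.{u}) :=
    reflectsColimitsOfShape_of_reflectsIsomorphisms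
  refine ⟨isColimitOfReflects (forget AddCommGrpCat.{u})
    (Types.FilteredColimit.isColimitOf' _ _ ?_ ?_)⟩
  · intro x
    obtain ⟨s, rfl⟩ := he c.pt x
    obtain ⟨j, t, ht⟩ := exists_common_stage hc m.support s
    refine ⟨j, (e.app (K.obj j)).hom t, ?_⟩
    refine Eq.trans ?_ (AddCommGrpCat.naturality_apply e (c.ι.app j) t)
    apply hι
    refine (hem c.pt s).trans (Eq.trans ?_ (hem c.pt fun i => (c.ι.app j).hom (t i)).symm)
    exact Finset.sum_congr rfl fun i hi => congrArg (tmul R (m i)) (ht i hi).symm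
  · intro j (x : F.obj (K.obj j)) (y : F.obj (K.obj j)) hxy
    obtain ⟨k, f, hk⟩ := exists_map_eq_zero (M := M) hc
      ((ι.app (K.obj j)).hom (x - y)) (by
        refine (AddCommGrpCat.naturality_apply ι (c.ι.app j) _).symm.trans ?_
        rw [map_sub, sub_eq_zero.2]
        · exact map_zero _
        · exact hxy)
    refine ⟨k, f, ?_⟩
    have h0 : (F.map (K.map f)).hom (x - y) = 0 := by
      apply hι
      rw [map_zero]
      exact (AddCommGrpCat.naturality_apply ι (K.map f) _).trans hk
    rw [map_sub, sub_eq_zero] at h0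
    exact h0

end Images

/-! ### Images of morphisms ∏_I 𝓡 → 𝓜 and the equivalences -/

open TensorOver

variable {R : Type u} [Ring R] {M : Type u} [AddCommGroup M] [Module Rᵐᵒᵖ M]

theorem image_ι_injective {P G : ModuleCat.{u} R ⥤ AddCommGrpCat.{u}} (f : P ⟶ G)
    (S : ModuleCat.{u} R) : Function.Injective ((image.ι f).app S).hom :=
  (AddCommGrpCat.mono_iff_injective _).1 ((NatTrans.mono_iff_mono_app _).1 inferInstance S)

theorem isFPModule_image (h : IsMittagLeffler R M) {I : Type} [Countable I]
    (f : ringFunctorPower R I ⟶ quasiCoherent R M) : IsFPModule (image f) := by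
  let e : powerFunctor R I ⟶ image f := (powerFunctorIso R I).hom ≫ factorThruImage f
  have he : ∀ S, Function.Surjective (e.app S).hom := by
    intro S
    have : Epi e := inferInstance
    exact (AddCommGrpCat.epi_iff_surjective _).1 ((NatTrans.epi_iff_epi_app _).1 this S)
  have hι := image_ι_injective f
  exact ⟨additive_of_injective _ hι, preservesDirectLimits_of_injective _ hι e he,
    preservesDirectProducts_of_injectiveOnProducts _ hι
      (isMittagLeffler_iff_injectiveOnProducts.1 h) e he⟩

theorem eq_zero_of_preservesDirectProducts_image {I : Type} [Countable I]
    (h : ∀ f : ringFunctorPower R I ⟶ quasiCoherent R M, PreservesDirectProducts (image f))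
    (m : I →₀ M) (J : Type u) (S : J → Type u) [∀ j, AddCommGroup (S j)] [∀ j, Module R (S j)]
    (s : I → ∀ j, S j) (hs : ∀ j, (m.sum fun i p => tmul R p (s i j)) = 0) :
    (m.sum fun i p => tmul R p (s i)) = 0 := by
  let f : ringFunctorPower R I ⟶ quasiCoherent R M :=
    (powerFunctorIso R I).inv ≫ powerFunctorHom m
  refine eq_zero_of_preservesDirectProducts (image.ι f) (h f)
    ((powerFunctorIso R I).hom ≫ factorThruImage f) m ?_ (image_ι_injective f) J S s hs
  rw [Category.assoc, image.fac, Iso.hom_inv_id_assoc]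

theorem isMittagLeffler_of_fin
    (h : ∀ (n : ℕ) (f : ringFunctorPower R (Fin n) ⟶ quasiCoherent R M),
      PreservesDirectProducts (image f)) : IsMittagLeffler R M := by
  refine isMittagLeffler_iff_injectiveOnProducts.2 fun J S _ _ x hx => ?_
  obtain ⟨n, m, s, rfl⟩ := exists_eq_sum x
  have hm : ∀ {T : Type u} [AddCommGroup T] [Module R T] (t : Fin n → T),
      ((Finsupp.equivFunOnFinite.symm m).sum fun i p => tmul R p (t i)) =
        ∑ i, tmul R (m i) (t i) := by
    intro T _ _ t
    rw [Finsupp.sum_fintype _ _ (by simp)]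
    rfl
  rw [← hm]
  refine eq_zero_of_preservesDirectProducts_image (h n) _ J S s fun j => ?_
  rw [hm, ← hx j, map_sum]
  rfl

theorem isMittagLeffler_of_nat
    (h : ∀ f : ringFunctorPower R ℕ ⟶ quasiCoherent R M, PreservesDirectProducts (image f)) :
    IsMittagLeffler R M := by
  refine isMittagLeffler_iff_injectiveOnProducts.2 fun J S _ _ x hx => ?_
  obtain ⟨n, m, s, rfl⟩ := exists_eq_sum x
  let m' : ℕ →₀ M := (Finsupp.equivFunOnFinite.symm m).embDomain Fin.valEmbedding
  -- The extension by zero is immaterial, since m' is supported on indices below n.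
  let s' : ℕ → ∀ j, S j := fun k => if hk : k < n then s ⟨k, hk⟩ else 0
  have hs' : ∀ i : Fin n, s' (Fin.valEmbedding i) = s i := fun i => by simp [s']
  have hm : ∀ {T : Type u} [AddCommGroup T] [Module R T] (t : ℕ → T),
      (m'.sum fun i p => tmul R p (t i)) = ∑ i, tmul R (m i) (t (Fin.valEmbedding i)) := by
    intro T _ _ t
    rw [Finsupp.sum_embDomain, Finsupp.sum_fintype _ _ (by simp)]
    rfl
  have h0 := eq_zero_of_preservesDirectProducts_image h m' J S s' fun j => by
    rw [hm (fun i => s' i j), ← hx j, map_sum]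
    exact Finset.sum_congr rfl fun i _ => by rw [hs']; rfl
  rw [hm] at h0
  simpa only [hs'] using h0

theorem mainTheorem6 (R : Type u) [Ring R] (M : Type u) [AddCommGroup M] [Module Rᵐᵒᵖ M] :
    (IsMittagLeffler R M ↔
      ∀ (n : ℕ) (f : ringFunctorPower R (Fin n) ⟶ quasiCoherent R M), IsFPModule (image f)) ∧
    (IsMittagLeffler R M ↔
      ∀ f : ringFunctorPower R ℕ ⟶ quasiCoherent R M, IsFPModule (image f)) ∧
    (IsMittagLeffler R M ↔
      ∀ f : ringFunctorPower R ℕ ⟶ quasiCoherent R M, PreservesDirectProducts (image f)) :=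
  ⟨⟨fun h _ f => isFPModule_image h f,
      fun h => isMittagLeffler_of_fin fun n f => (h n f).directProducts⟩,
    ⟨fun h f => isFPModule_image h f,
      fun h => isMittagLeffler_of_nat fun f => (h f).directProducts⟩,
    ⟨fun h f => (isFPModule_image h f).directProducts, isMittagLeffler_of_nat⟩⟩
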